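/- **Model.** Let $\overline X>0$ and let $P:[0,\infty)\to\mathbb R$ be an inverse demand function that is smooth and strictly decreasing on $[0,\overline X]$ and satisfies $P(X)=0$ if and only if $X\ge\overline X$. Let $c\ge 0$ be a marginal cost, and let $\overline X_c\in[0,\overline X]$ be the competitive quantity, $P(\overline X_c)=c$. Assume that $P'(\overline X_c)\neq 0$ (one-sided derivative if $\overline X_c$ is an endpoint of $[0,\overline X]$). For every $T$ and every sequence $\boldsymbol n=(n_1,\dots,n_T)$ of non-negative integers consider the following game. In period $t$ a set $\mathcal I_t$ of $n_t$ firms arrives. They observe the cumulative quantity $X_{t-1}$ of all firms that arrived in earlier periods and simultaneously choose quantities $x_i\ge 0$. Firm $i$ has profit $x_i\,(P(X)-c)$, where $X$ is the total quantity of all firms at the end of the game. An equilibrium is a pure-strategy subgame perfect equilibrium that is interior: at every history with cumulative quantity below $\overline X$, the total quantity resulting from equilibrium play is below $\overline X$ (this holds automatically if $c>0$). Suppose that every game $\boldsymbol n$ has an equilibrium, and let $x_i^*(\boldsymbol n)$ be the equilibrium quantities (of any selection of one equilibrium for each $\boldsymbol n$). The model has the *Stackelberg independence property* if, for all $\boldsymbol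 n=(n_1,\dots,n_T)$, all periods $t\le T$, all $i\in\mathcal I_t$, and all $\hat{\boldsymbol n}=(\hat n_1,\dots,\hat n_{\hat T})$ with $\hat T\ge t$ and $\hat n_s=n_s$ for all $s\le t$, one has $x_i^*(\hat{\boldsymbol n})=x_i^*(\boldsymbol n)$. **Corollary 1 (Competitive Limits and Stackelberg Independence).** If the model has the Stackelberg independence property, then for every $\boldsymbol n=(n_1,\dots,n_T)$, every period $s<T$ and every firm $i\in\mathcal I_s$, $$x_i^*(\boldsymbol n)=\frac{\overline X_c}{\prod_{k=1}^{s}(1+n_k)}.$$ -/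

import Mathlib

open scoped ContDiff

namespace Stackelberg

/-- An inverse demand function `P` with saturation point `Xbar > 0`: smooth and strictly decreasing
on `[0, Xbar]`, and for quantities `X ≥ 0` the price is zero exactly when `X ≥ Xbar`. -/
structure IsDemand (P : ℝ → ℝ) (Xbar : ℝ) : Prop where
  pos : 0 < Xbar
  smooth : ContDiffOn ℝ ∞ P (Set.Icc 0 Xbar)
  strictAnti : StrictAntiOn P (Set.Icc 0 Xbar)
  zero_iff : ∀ X, 0 ≤ X → (P X = 0 ↔ Xbar ≤ X)

/-- A pure strategy profile for the arrival sequence `n`: there are `T` periods (numbered from `0`),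
`n t` firms arrive in period `t`, and each of them chooses a quantity as a function of the
cumulative quantity of all firms that arrived in earlier periods. -/
abbrev Profile {T : ℕ} (n : Fin T → ℕ) : Type := (t : Fin T) → Fin (n t) → ℝ → ℝ

/-- The cumulative quantity after period `t` if it is `Y` before period `t` and the firms arriving
in period `t` follow `σ` (nobody arrives from period `T` on). -/
def step {T : ℕ} {n : Fin T → ℕ} (σ : Profile n) (t : ℕ) (Y : ℝ) : ℝ :=
  if h : t < T then Y + ∑ i, σ ⟨t, h⟩ i Y else Y

/-- The cumulative quantity after the `r` periods `t, …, t + r - 1`, if it is `Y` before period `t`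
and all firms follow `σ`. -/
def cumAfter {T : ℕ} {n : Fin T → ℕ} (σ : Profile n) : ℕ → ℕ → ℝ → ℝ
  | 0, _, Y => Y
  | r + 1, t, Y => cumAfter σ r (t + 1) (step σ t Y)

/-- The total quantity at the end of the game, if the cumulative quantity before period `t` is `Y`
and all firms arriving from period `t` on follow `σ`. -/
def finalTotal {T : ℕ} {n : Fin T → ℕ} (σ : Profile n) (t : ℕ) (Y : ℝ) : ℝ :=
  cumAfter σ (T - t) t Y

/-- The profit of firm `i` of period `t`, with constant marginal cost `c`, if the cumulative
quantity of its leaders is `Y`, the firms of period `t` choose the quantities `q`, and all later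
firms follow `σ`. -/
def profit (P : ℝ → ℝ) (c : ℝ) {T : ℕ} {n : Fin T → ℕ} (σ : Profile n) (t : Fin T) (Y : ℝ)
    (q : Fin (n t) → ℝ) (i : Fin (n t)) : ℝ :=
  q i * (P (finalTotal σ (t + 1) (Y + ∑ j, q j)) - c)

/-- The cumulative quantities that can be observed at the beginning of period `t`: all `Y ≥ 0`, but
only `Y = 0` if no firm has arrived before. -/
def Reachable {T : ℕ} (n : Fin T → ℕ) (t : Fin T) (Y : ℝ) : Prop :=
  0 ≤ Y ∧ ((∀ s, s < t → n s = 0) → Y = 0)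

/-- Interior subgame perfect equilibria in pure strategies. After every history, no firm arriving
next can gain by a deviation to another quantity, given the other firms of its period and the
reactions of the followers. Interiority says that play never saturates a market that is not
saturated yet; it follows from the other two conditions if `c > 0`, and for `c = 0` it rules out
the equilibria in which firms flood the market and each of them earns zero whatever it does. -/
structure IsEquilibrium (P : ℝ → ℝ) (Xbar c : ℝ) {T : ℕ} (n : Fin T → ℕ) (σ : Profile n) :
    Prop where
  nonneg : ∀ t i Y, 0 ≤ Y → 0 ≤ σ t i Y
  best : ∀ t Y, Reachable n t Y → ∀ (i : Fin (n t)) (y : ℝ), 0 ≤ y →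
    profit P c σ t Y (Function.update (fun j => σ t j Y) i y) i ≤
      profit P c σ t Y (fun j => σ t j Y) i
  interior : ∀ t Y, Reachable n t Y → Y < Xbar → finalTotal σ t Y < Xbar

/-- The cumulative quantity before period `t` on the path of play of `σ`. -/
def cumBefore {T : ℕ} {n : Fin T → ℕ} (σ : Profile n) : ℕ → ℝ
  | 0 => 0
  | t + 1 => step σ t (cumBefore σ t)

/-- The quantities of all firms on the path of play of `σ`. -/
def outcome {T : ℕ} {n : Fin T → ℕ} (σ : Profile n) (t : Fin T) (i : Fin (n t)) : ℝ :=
  σ t i (cumBefore σ t)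

/-- A quantity for every firm in every game, one game for each arrival sequence. -/
abbrev Quantities : Type := (T : ℕ) → (n : Fin T → ℕ) → (t : Fin T) → Fin (n t) → ℝ

/-- `x T n` lists equilibrium quantities of the game `n`, for every arrival sequence `n`. -/
def AreEquilibriumQuantities (P : ℝ → ℝ) (Xbar c : ℝ) (x : Quantities) : Prop :=
  ∀ (T : ℕ) (n : Fin T → ℕ), ∃ σ : Profile n, IsEquilibrium P Xbar c n σ ∧ x T n = outcome σ

/-- Stackelberg independence: if `n` and `n'` have the same number of arrivals in all periods up to
and including `t`, then each firm of period `t` chooses the same quantity in both games. -/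
def StackelbergIndependent (x : Quantities) : Prop :=
  ∀ (T T' : ℕ) (n : Fin T → ℕ) (n' : Fin T' → ℕ) (t : Fin T) (t' : Fin T'), t.val = t'.val →
    (∀ (s : Fin T) (s' : Fin T'), s.val = s'.val → s ≤ t → n' s' = n s) →
    ∀ (i : Fin (n t)) (i' : Fin (n' t')), i.val = i'.val → x T' n' t' i' = x T n t i

end Stackelberg

open Set Filter Topology

namespace Stackelberg

/-! ### Demand, Cournot followers and the leader's first-order condition. -/

section Market

variable {P : ℝ → ℝ} {Xbar c Xc : ℝ}

/-! Independence lets the firms of one period be studied in a game that ends with one further period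
of `N` followers, for any `N`. Let `Z` be the cumulative quantity after the leaders. The followers'
Cournot conditions say that the final total `X` satisfies `X - Z = N * g X` with `g = -(P - c) /
P'`. Eliminating `N` from the first-order condition of a leader with quantity `x` gives `x = g X -
(X - Z) * g' X`. Neither `x` nor `Z` depends on `N`, whereas `X` tends to `Xc` as `N` grows, where
`g = 0` and `g' = -1`. Hence `x = Xc - Z` (`leader_quantity`).

All `k` firms of the period thus choose the same `x`. If their leaders produced `Y`, then `Z = Y + k
* x` and `x = (Xc - Y) / (1 + k)` (`quantity_eq_share`). Each period divides the gap to `Xc` by `1 +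
k`, and induction yields the product (`competitive_sub_leaderTotal`). -/

theorem IsDemand.cost_lt (hP : IsDemand P Xbar) (hXc : Xc ∈ Icc 0 Xbar) (hPXc : P Xc = c)
    {X : ℝ} (h0 : 0 ≤ X) (hX : X < Xc) : c < P X := by
  rw [← hPXc]
  exact hP.strictAnti ⟨h0, hX.le.trans hXc.2⟩ hXc hX

theorem IsDemand.lt_cost (hP : IsDemand P Xbar) (hXc : Xc ∈ Icc 0 Xbar) (hPXc : P Xc = c)
    {X : ℝ} (hX : Xc < X) (hb : X ≤ Xbar) : P X < c := by
  rw [← hPXc]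
  exact hP.strictAnti hXc ⟨hXc.1.trans hX.le, hb⟩ hX

theorem IsDemand.hasDerivWithinAt (hP : IsDemand P Xbar) {X : ℝ} (hX : X ∈ Icc 0 Xbar) :
    HasDerivWithinAt P (derivWithin P (Icc 0 Xbar) X) (Icc 0 Xbar) X :=
  ((hP.smooth.differentiableOn (by simp)) X hX).hasDerivWithinAt

theorem IsDemand.hasDerivAt (hP : IsDemand P Xbar) {X : ℝ} (hX : X ∈ Ioo 0 Xbar) :
    HasDerivAt P (derivWithin P (Icc 0 Xbar) X) X :=
  (hP.hasDerivWithinAt (Ioo_subset_Icc_self hX)).hasDerivAt (Icc_mem_nhds hX.1 hX.2)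

theorem IsDemand.contDiffOn_derivWithin (hP : IsDemand P Xbar) :
    ContDiffOn ℝ 1 (derivWithin P (Icc 0 Xbar)) (Icc 0 Xbar) :=
  hP.smooth.derivWithin (uniqueDiffOn_Icc hP.pos) (by norm_cast)

theorem IsDemand.hasDerivAt_derivWithin (hP : IsDemand P Xbar) {X : ℝ} (hX : X ∈ Ioo 0 Xbar) :
    HasDerivAt (derivWithin P (Icc 0 Xbar))
      (derivWithin (derivWithin P (Icc 0 Xbar)) (Icc 0 Xbar) X) X :=
  ((hP.contDiffOn_derivWithin.differentiableOn (by simp)) X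
    (Ioo_subset_Icc_self hX)).hasDerivWithinAt.hasDerivAt (Icc_mem_nhds hX.1 hX.2)

/-- Firms with positive quantities never push the total above the competitive quantity. -/
theorem nonpos_of_competitive_lt (hP : IsDemand P Xbar) (hXc : Xc ∈ Icc 0 Xbar)
    (hPXc : P Xc = c) {X q : ℝ} (hX : Xc < X) (hb : X ≤ Xbar) (h : 0 ≤ q * (P X - c)) :
    q ≤ 0 := by
  have := hP.lt_cost hXc hPXc hX hb
  by_contra! hq
  nlinarith

/-- The first-order condition of a firm of the last period. -/
theorem cournot_foc (hP : IsDemand P Xbar) {X q : ℝ} (hX : X ∈ Ioo 0 Xbar) (hq : 0 < q)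
    (hbest : ∀ y, 0 ≤ y → y * (P (X - q + y) - c) ≤ q * (P X - c)) :
    P X - c + q * derivWithin P (Icc 0 Xbar) X = 0 := by
  have hmax : IsLocalMax (fun y => y * (P (X - q + y) - c)) q := by
    filter_upwards [lt_mem_nhds hq] with y hy
    simpa using hbest y hy.le
  have hd : HasDerivAt (fun y => P (X - q + y)) (derivWithin P (Icc 0 Xbar) X) q := by
    have h1 : HasDerivAt P (derivWithin P (Icc 0 Xbar) X) (X - q + q) := by
      simpa using hP.hasDerivAt hX
    simpa using h1.comp_const_add (X - q) q
  have := hmax.hasDerivAt_eq_zero ((hasDerivAt_id q).mul (hd.sub_const c))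
  simpa using this

/-- The total quantity when `N` firms play Cournot after the cumulative quantity `Y`. -/
theorem cournot_total (hP : IsDemand P Xbar) (hXc : Xc ∈ Icc 0 Xbar) (hPXc : P Xc = c)
    (hP' : derivWithin P (Icc 0 Xbar) Xc ≠ 0) {N : ℕ} (q : Fin N → ℝ) (hN : 0 < N)
    (hq : ∀ i, 0 ≤ q i) {Y X : ℝ} (hY : 0 ≤ Y) (hYXc : Y < Xc) (hX : X = Y + ∑ i, q i)
    (hXb : X < Xbar)
    (hbest : ∀ i y, 0 ≤ y → y * (P (X - q i + y) - c) ≤ q i * (P X - c)) :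
    X < Xc ∧ (X - Y) * derivWithin P (Icc 0 Xbar) X = -(N * (P X - c)) := by
  have hYX : Y ≤ X := by
    have := Finset.sum_nonneg (s := Finset.univ) fun i _ => hq i
    linarith
  have hpos : Y < X → ∃ i, 0 < q i := by
    intro h
    by_contra! hn
    have := Finset.sum_nonpos (s := Finset.univ) fun i _ => hn i
    linarith
  have hle : X ≤ Xc := by
    by_contra! h
    obtain ⟨i, hi⟩ := hpos (hYXc.trans h)
    exact absurd (nonpos_of_competitive_lt hP hXc hPXc h hXb.le
      (by simpa using hbest i 0 le_rfl)) (not_le.2 hi)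
  have hlt : X < Xc := by
    -- At `Xc` the markup vanishes, so the first-order condition of an active firm would force `P' =
    -- 0` there.
    refine hle.lt_of_ne fun h => ?_
    obtain ⟨i, hi⟩ := hpos (h ▸ hYXc)
    have := cournot_foc hP ⟨by linarith, hXb⟩ hi (hbest i)
    rw [h, hPXc, sub_self, zero_add] at this
    exact (mul_ne_zero hi.ne' hP') this
  refine ⟨hlt, ?_⟩
  have hPX := hP.cost_lt hXc hPXc (hY.trans hYX) hlt
  have hqpos : ∀ i, 0 < q i := by
    intro i
    refine (hq i).lt_of_ne' fun h => ?_
    -- An inactive firm would profit from filling half of the gap to `Xc`.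
    have h1 := hbest i ((Xc - X) / 2) (by linarith)
    have h2 := hP.cost_lt hXc hPXc (X := X + (Xc - X) / 2) (by linarith) (by linarith)
    rw [h, sub_zero, zero_mul] at h1
    nlinarith
  have hX0 : 0 < X := by
    have := hqpos ⟨0, hN⟩
    have := Finset.single_le_sum (f := q) (fun i _ => hq i) (Finset.mem_univ ⟨0, hN⟩)
    linarith
  have hsum : ∑ i, (P X - c + q i * derivWithin P (Icc 0 Xbar) X) = 0 :=
    Finset.sum_eq_zero fun i _ => cournot_foc hP ⟨hX0, hXb⟩ (hqpos i) (hbest i)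
  rw [Finset.sum_add_distrib, ← Finset.sum_mul] at hsum
  simp only [Finset.sum_const, Finset.card_univ, Fintype.card_fin, nsmul_eq_mul] at hsum
  rw [hX] at hsum ⊢
  linear_combination hsum

/-- Leaders leave room for their followers and are all active. -/
theorem leaders_active (hP : IsDemand P Xbar) (hXc : Xc ∈ Icc 0 Xbar) (hPXc : P Xc = c)
    {k : ℕ} (q : Fin k → ℝ) (hq : ∀ i, 0 ≤ q i) {Y Z : ℝ} (hY : 0 ≤ Y) (hYXc : Y < Xc)
    (hZ : Z = Y + ∑ i, q i) {R : ℝ → ℝ} (hR : ∀ W, 0 ≤ W → W ≤ R W)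
    (hRc : ∀ W, 0 ≤ W → W < Xc → R W < Xc) (hb : R Z < Xbar)
    (hbest : ∀ i y, 0 ≤ y → y * (P (R (Z - q i + y)) - c) ≤ q i * (P (R Z) - c)) :
    Z < Xc ∧ ∀ i, 0 < q i := by
  have hqZ : ∀ i, q i ≤ Z := fun i => by
    have := Finset.single_le_sum (f := q) (fun i _ => hq i) (Finset.mem_univ i)
    linarith
  have hYZ : Y ≤ Z := by
    have := Finset.sum_nonneg (s := Finset.univ) fun i _ => hq i
    linarith
  have hlt : Z < Xc := by
    by_contra! hge
    obtain ⟨i, hi⟩ : ∃ i, 0 < q i := by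
      by_contra! hn
      have := Finset.sum_nonpos (s := Finset.univ) fun i _ => hn i
      linarith
    have hRle : R Z ≤ Xc := by
      by_contra! h
      exact absurd (nonpos_of_competitive_lt hP hXc hPXc h hb.le
        (by simpa using hbest i 0 le_rfl)) (not_le.2 hi)
    have hRZ := hR Z (hY.trans hYZ)
    have hRe : R Z = Xc := le_antisymm hRle (hge.trans hRZ)
    have hZe : Z = Xc := le_antisymm (hRZ.trans hRle) hge
    -- At `Xc` the leader earns zero; halving its quantity brings the final total below `Xc` and
    -- earns a positive profit.
    have h1 := hbest i (q i / 2) (by linarith)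
    have h0 : 0 ≤ Z - q i + q i / 2 := by linarith [hqZ i]
    have h2 := hP.cost_lt hXc hPXc (h0.trans (hR _ h0)) (hRc _ h0 (by linarith))
    rw [hRe, hPXc, sub_self, mul_zero] at h1
    nlinarith
  refine ⟨hlt, fun i => (hq i).lt_of_ne' fun h => ?_⟩
  have h1 := hbest i ((Xc - Z) / 2) (by linarith)
  rw [h, sub_zero, zero_mul] at h1
  have h0 : 0 ≤ Z + (Xc - Z) / 2 := by linarith
  have h2 := hP.cost_lt hXc hPXc (h0.trans (hR _ h0)) (hRc _ h0 (by linarith))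
  nlinarith

/-- A quantity `x` that is optimal for a leader against arbitrarily many followers, while the
cumulative quantity `Z` of the leader's period is the same, equals the gap `Xc - Z`. -/
theorem leader_quantity (hP : IsDemand P Xbar) (hXc : Xc ∈ Icc 0 Xbar) (hPXc : P Xc = c)
    (hP' : derivWithin P (Icc 0 Xbar) Xc ≠ 0) {Z x : ℝ} (hx : 0 < x) (hxZ : x ≤ Z)
    (hZ : Z < Xc)
    (h : ∀ N : ℕ, 0 < N → ∃ R : ℝ → ℝ, (∀ W, 0 ≤ W → W ≤ R W) ∧
      (∀ W, 0 ≤ W → W < Xc → R W < Xc ∧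
        (R W - W) * derivWithin P (Icc 0 Xbar) (R W) = -(N * (P (R W) - c))) ∧
      ∀ y, 0 ≤ y → y * (P (R (Z - x + y)) - c) ≤ x * (P (R Z) - c)) :
    x = Xc - Z := by
  set p := derivWithin P (Icc 0 Xbar) with hp
  set p₂ := derivWithin p (Icc 0 Xbar) with hp₂
  -- `g X` is the quantity of each follower at the final total `X`, and `g'` is its derivative by
  -- the quotient rule.
  set g : ℝ → ℝ := fun X => -(P X - c) / p X with hg
  set g' : ℝ → ℝ := fun X => (-p X * p X - -(P X - c) * p₂ X) / p X ^ 2 with hg'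
  have hcP : ContinuousWithinAt P (Icc 0 Xbar) Xc := (hP.hasDerivWithinAt hXc).continuousWithinAt
  have hcp : ContinuousOn p (Icc 0 Xbar) := hP.contDiffOn_derivWithin.continuousOn
  have hcp₂ : ContinuousWithinAt p₂ (Icc 0 Xbar) Xc :=
    hP.contDiffOn_derivWithin.continuousOn_derivWithin (uniqueDiffOn_Icc hP.pos) le_rfl Xc hXc
  have hcpc := hcp Xc hXc
  have hcPc : ContinuousWithinAt (fun X => -(P X - c)) (Icc 0 Xbar) Xc :=
    (hcP.sub continuousWithinAt_const).neg
  have hcg : ContinuousWithinAt g (Icc 0 Xbar) Xc := hcPc.div hcpc hP'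
  have hcg' : ContinuousWithinAt g' (Icc 0 Xbar) Xc :=
    ((hcpc.neg.mul hcpc).sub (hcPc.mul hcp₂)).div (hcpc.pow 2) (pow_ne_zero 2 hP')
  have hgc : g Xc = 0 := by simp [hg, hPXc]
  have hgc' : g' Xc = -1 := by
    simp only [hg', hPXc]
    field_simp
    ring
  have hcF : ContinuousWithinAt (fun X => g X - (X - Z) * g' X) (Icc 0 Xbar) Xc :=
    hcg.sub ((continuousWithinAt_id.sub continuousWithinAt_const).mul hcg')
  by_contra hne
  have hFc : g Xc - (Xc - Z) * g' Xc ≠ x := by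
    rw [hgc, hgc']
    intro h'
    exact hne (by linarith)
  -- If `x ≠ Xc - Z`, the limiting first-order condition fails at `Xc`, hence by continuity also
  -- near `Xc`. A single large `N` then gives a contradiction.
  have hev : ∀ᶠ X in 𝓝[Icc 0 Xbar] Xc, p X ≠ 0 ∧ g' X < 0 ∧ g X - (X - Z) * g' X ≠ x :=
    (hcpc.eventually_ne hP').and
      ((hcg'.eventually_lt_const (by rw [hgc']; norm_num)).and (hcF.eventually_ne hFc))
  rw [eventually_nhdsWithin_iff, Metric.eventually_nhds_iff] at hev
  obtain ⟨δ, hδ, hev⟩ := hev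
  set a := max (Xc - δ) 0 with ha
  have ha0 : 0 ≤ a := le_max_right _ _
  have haXc : a < Xc := max_lt (by linarith) (by linarith)
  have hnear : ∀ X ∈ Ioo a Xc, p X ≠ 0 ∧ g' X < 0 ∧ g X - (X - Z) * g' X ≠ x := by
    intro X hX
    have h1 : Xc - δ < X := (le_max_left _ _).trans_lt hX.1
    refine hev ?_ ⟨ha0.trans hX.1.le, hX.2.le.trans hXc.2⟩
    rw [Real.dist_eq, abs_lt]
    constructor <;> linarith [hX.2]
  have hI : ∀ X ∈ Ioo a Xc, X ∈ Ioo 0 Xbar := fun X hX =>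
    ⟨ha0.trans_lt hX.1, hX.2.trans_le hXc.2⟩
  have hdg : ∀ X ∈ Ioo a Xc, HasDerivAt g (g' X) X := fun X hX =>
    ((hP.hasDerivAt (hI X hX)).sub_const c).neg.div (hP.hasDerivAt_derivWithin (hI X hX))
      (hnear X hX).1
  obtain ⟨M, hM⟩ := isCompact_Icc.exists_bound_of_continuousOn hcp
  have hPa := hP.cost_lt hXc hPXc ha0 haXc
  -- A total `R W ≤ a` would give `N * (P a - c) ≤ (R W - W) * |p (R W)| ≤ Xbar * M`. This `N`
  -- excludes that, so all reactions to `W < Xc` lie in `Ioo a Xc`.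
  obtain ⟨N, hN⟩ := exists_nat_gt (max 0 (Xbar * M / (P a - c)))
  have hN0 : (0 : ℝ) < N := (le_max_left _ _).trans_lt hN
  have hNM : Xbar * M < N * (P a - c) := by
    rw [← div_lt_iff₀ (by linarith)]
    exact (le_max_right _ _).trans_lt hN
  obtain ⟨R, hR, hRc, hbest⟩ := h N (by exact_mod_cast hN0)
  have hRI : ∀ W, 0 ≤ W → W < Xc → R W ∈ Ioo a Xc := by
    intro W h0 hW
    obtain ⟨h1, h2⟩ := hRc W h0 hW
    refine ⟨?_, h1⟩
    by_contra! h3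
    have h4 := hR W h0
    have h5 : P a ≤ P (R W) := hP.strictAnti.antitoneOn ⟨h0.trans h4, by linarith [hXc.2]⟩
      ⟨ha0, by linarith [hXc.2]⟩ h3
    have h6 : ‖p (R W)‖ ≤ M := hM _ ⟨h0.trans h4, by linarith [hXc.2]⟩
    rw [Real.norm_eq_abs, abs_le] at h6
    have h7 : (R W - W) * (-p (R W)) ≤ Xbar * M :=
      mul_le_mul_of_nonneg (by linarith [hXc.2]) (by linarith [h6.1]) (by linarith)
        (by linarith [h6.1, h6.2])
    nlinarith [mul_le_mul_of_nonneg_left h5 hN0.le]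
  -- No regularity of `R` is assumed. Its inverse `f` is explicit and strictly increasing near `Xc`.
  set f : ℝ → ℝ := fun X => X - N * g X with hf
  have hdf : ∀ X ∈ Ioo a Xc, HasDerivAt f (1 - N * g' X) X := fun X hX =>
    (hasDerivAt_id X).sub ((hdg X hX).const_mul (N : ℝ))
  have hfmono : StrictMonoOn f (Ioo a Xc) := by
    refine strictMonoOn_of_deriv_pos (convex_Ioo _ _)
      (fun X hX => (hdf X hX).continuousAt.continuousWithinAt) fun X hX => ?_
    rw [interior_Ioo] at hX
    rw [(hdf X hX).deriv]
    nlinarith [(hnear X hX).2.1]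
  have hfR : ∀ W, 0 ≤ W → W < Xc → f (R W) = W := by
    intro W h0 hW
    have h1 := (hRc W h0 hW).2
    have h2 := (hnear _ (hRI W h0 hW)).1
    simp only [hf, hg]
    field_simp
    linear_combination h1
  have hZ0 : 0 < Z := hx.trans_le hxZ
  set X := R Z with hX
  have hXI : X ∈ Ioo a Xc := hRI Z hZ0.le hZ
  have hfX : f X = Z := hfR Z hZ0.le hZ
  have hfc : ContinuousAt f X := (hdf X hXI).continuousAt
  have hRf : ∀ᶠ V in 𝓝 X, R (f V) = V := by
    filter_upwards [Ioo_mem_nhds hXI.1 hXI.2,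
      hfc.eventually (Ioo_mem_nhds (hfX ▸ hZ0) (hfX ▸ hZ))] with V hV hfV
    exact hfmono.injOn (hRI _ hfV.1.le hfV.2) hV (hfR _ hfV.1.le hfV.2)
  -- The leader's choice is parametrized by the final total `V` that it induces, so only `f` is
  -- differentiated.
  have hmax : IsLocalMax (fun V => (x - Z + f V) * (P V - c)) X := by
    filter_upwards [hRf, hfc.eventually (lt_mem_nhds (a := Z - x) (by linarith))] with V hV hfV
    have h1 := hbest (x - Z + f V) (by linarith)
    rw [show Z - x + (x - Z + f V) = f V by ring, hV] at h1
    simpa [hfX] using h1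
  have hfoc := hmax.hasDerivAt_eq_zero (((hdf X hXI).const_add (x - Z)).mul
    ((hP.hasDerivAt (hI X hXI)).sub_const c))
  obtain ⟨h1, -, h3⟩ := hnear X hXI
  apply h3
  have h4 : g X * p X = -(P X - c) := div_mul_cancel₀ _ h1
  rw [hfX, show x - Z + Z = x by ring] at hfoc
  have h5 : X - N * g X = Z := hfX
  apply mul_right_cancel₀ h1
  linear_combination (1 - N * g' X) * h4 - g' X * p X * h5 - hfoc

end Market

/-! ### Equilibrium play and deviations in terms of cumulative quantities. -/

section Game

variable {P : ℝ → ℝ} {Xbar c : ℝ} {T : ℕ} {n : Fin T → ℕ} {σ : Profile n}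

theorem step_of_lt {t : ℕ} (h : t < T) (Y : ℝ) : step σ t Y = Y + ∑ i, σ ⟨t, h⟩ i Y :=
  dif_pos h

theorem finalTotal_step {t : ℕ} (h : t < T) (Y : ℝ) :
    finalTotal σ t Y = finalTotal σ (t + 1) (step σ t Y) := by
  rw [finalTotal, finalTotal, show T - t = T - (t + 1) + 1 by omega, cumAfter]

theorem finalTotal_end (Y : ℝ) : finalTotal σ T Y = Y := by
  rw [finalTotal, Nat.sub_self, cumAfter]

theorem IsEquilibrium.le_step (h : IsEquilibrium P Xbar c n σ) (t : ℕ) {Y : ℝ} (hY : 0 ≤ Y) :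
    Y ≤ step σ t Y := by
  unfold step
  split_ifs
  · exact le_add_of_nonneg_right (Finset.sum_nonneg fun i _ => h.nonneg _ i Y hY)
  · exact le_rfl

theorem IsEquilibrium.le_cumAfter (h : IsEquilibrium P Xbar c n σ) (r : ℕ) :
    ∀ (t : ℕ) {Y : ℝ}, 0 ≤ Y → Y ≤ cumAfter σ r t Y := by
  induction r with
  | zero => exact fun _ _ _ => le_rfl
  | succ r ih =>
    intro t Y hY
    have := h.le_step t hY
    exact this.trans (ih (t + 1) (hY.trans this))

theorem IsEquilibrium.le_finalTotal (h : IsEquilibrium P Xbar c n σ) (t : ℕ) {Y : ℝ}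
    (hY : 0 ≤ Y) : Y ≤ finalTotal σ t Y :=
  h.le_cumAfter _ t hY

theorem IsEquilibrium.best_total (h : IsEquilibrium P Xbar c n σ) {t : ℕ} (ht : t < T) {Y : ℝ}
    (hr : Reachable n ⟨t, ht⟩ Y) (i : Fin (n ⟨t, ht⟩)) {y : ℝ} (hy : 0 ≤ y) :
    y * (P (finalTotal σ (t + 1) (step σ t Y - σ ⟨t, ht⟩ i Y + y)) - c) ≤
      σ ⟨t, ht⟩ i Y * (P (finalTotal σ (t + 1) (step σ t Y)) - c) := by
  have h1 := h.best ⟨t, ht⟩ Y hr i y hy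
  have h2 := Finset.sum_update_of_mem (Finset.mem_univ i) (fun j => σ ⟨t, ht⟩ j Y) y
  have h3 := Finset.sum_erase_eq_sub (f := fun j => σ ⟨t, ht⟩ j Y) (Finset.mem_univ i)
  rw [Finset.sdiff_singleton_eq_erase, h3] at h2
  simp only [profit, Function.update_self, h2] at h1
  rw [step_of_lt ht]
  convert h1 using 5
  ring

theorem IsEquilibrium.reachable_cumBefore (h : IsEquilibrium P Xbar c n σ) :
    ∀ (t : ℕ) (ht : t < T), Reachable n ⟨t, ht⟩ (cumBefore σ t)
  | 0, _ => ⟨le_rfl, fun _ => rfl⟩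
  | t + 1, ht => by
    have ht' : t < T := by omega
    obtain ⟨h0, hz⟩ := h.reachable_cumBefore t ht'
    refine ⟨h0.trans (h.le_step t h0), fun hn => ?_⟩
    have hzero := hz fun s hs => hn s (hs.trans (by simp [Fin.lt_def]))
    have hnt : n ⟨t, ht'⟩ = 0 := hn _ (by simp [Fin.lt_def])
    have : IsEmpty (Fin (n ⟨t, ht'⟩)) := hnt ▸ Fin.isEmpty
    rw [cumBefore, step_of_lt ht', hzero, Finset.univ_eq_empty, Finset.sum_empty, add_zero]

end Game

/-! ### Transfer between games and induction over periods. -/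

section Independence

/-- The game with the first `T` terms of the sequence `m` as arrivals. -/
abbrev arrivals (m : ℕ → ℕ) (T : ℕ) : Fin T → ℕ := fun k => m k

/-- The quantity that the firms arriving before period `s` choose together, each of them in the game
that ends with its own period. -/
def leaderTotal (x : Quantities) (m : ℕ → ℕ) (s : ℕ) : ℝ :=
  ∑ k ∈ Finset.range s, ∑ i, x (k + 1) (arrivals m (k + 1)) (Fin.last k) i

variable {P : ℝ → ℝ} {Xbar c Xc : ℝ} {x : Quantities}

/-- The game that ends with the firm's own period serves as a common reference for all
continuations. -/
theorem StackelbergIndependent.eq_last (hSI : StackelbergIndependent x) {m m' : ℕ → ℕ} {T s : ℕ}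
    (hs : s < T) (hm : ∀ k ≤ s, m' k = m k) (i : Fin (m' s)) (j : Fin (m s))
    (hij : i.val = j.val) :
    x T (arrivals m' T) ⟨s, hs⟩ i = x (s + 1) (arrivals m (s + 1)) (Fin.last s) j := by
  refine hSI (s + 1) T (arrivals m (s + 1)) (arrivals m' T) (Fin.last s) ⟨s, hs⟩ rfl ?_ j i hij.symm
  intro k k' hk _
  simp only [arrivals, ← hk]
  exact hm _ (by omega)

theorem StackelbergIndependent.cumBefore_eq (hSI : StackelbergIndependent x) {m m' : ℕ → ℕ}
    {T : ℕ} {σ : Profile (arrivals m' T)} (hσ : x T (arrivals m' T) = outcome σ) :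
    ∀ s, s ≤ T → (∀ k < s, m' k = m k) → cumBefore σ s = leaderTotal x m s
  | 0, _, _ => by simp [cumBefore, leaderTotal]
  | s + 1, hs, hm => by
    rw [cumBefore, step_of_lt (by omega : s < T), leaderTotal, Finset.sum_range_succ,
      ← leaderTotal, hSI.cumBefore_eq hσ s (by omega) fun k hk => hm k (by omega)]
    congr 1
    refine Fintype.sum_equiv (finCongr (hm s (by omega))) _ _ fun i => ?_
    rw [← hSI.eq_last (m := m) (by omega : s < T) (fun k hk => hm k (by omega)) i _ rfl, hσ,
      outcome, hSI.cumBefore_eq hσ s (by omega) fun k hk => hm k (by omega)]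

/-- Against `N` followers in one further period, the firms of period `s` face a reaction function
`R` of total quantities. -/
theorem exists_reaction (hP : IsDemand P Xbar) (hXc : Xc ∈ Icc 0 Xbar) (hPXc : P Xc = c)
    (hP' : derivWithin P (Icc 0 Xbar) Xc ≠ 0) (hx : AreEquilibriumQuantities P Xbar c x)
    (hSI : StackelbergIndependent x) (m : ℕ → ℕ) (s : ℕ) (hms : 0 < m s)
    (hlt : leaderTotal x m s < Xbar) {N : ℕ} (hN : 0 < N) :
    0 ≤ leaderTotal x m s ∧
    (∀ i, 0 ≤ x (s + 1) (arrivals m (s + 1)) (Fin.last s) i) ∧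
    ∃ R : ℝ → ℝ, (∀ W, 0 ≤ W → W ≤ R W) ∧ R (leaderTotal x m (s + 1)) < Xbar ∧
      (∀ W, 0 ≤ W → W < Xc → R W < Xc ∧
        (R W - W) * derivWithin P (Icc 0 Xbar) (R W) = -(N * (P (R W) - c))) ∧
      ∀ i y, 0 ≤ y →
        y * (P (R (leaderTotal x m (s + 1) -
          x (s + 1) (arrivals m (s + 1)) (Fin.last s) i + y)) - c) ≤
        x (s + 1) (arrivals m (s + 1)) (Fin.last s) i *
          (P (R (leaderTotal x m (s + 1))) - c) := by
  -- Only the first `s + 2` terms are played, so exactly one period of `N` followers comes after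
  -- period `s`.
  set m' : ℕ → ℕ := fun k => if k ≤ s then m k else N with hm'
  have hm : ∀ k ≤ s, m' k = m k := fun k hk => if_pos hk
  have hmN : m' (s + 1) = N := if_neg (by omega)
  have hs : s < s + 2 := by omega
  have hs1 : s + 1 < s + 2 := by omega
  obtain ⟨σ, hσ, hxσ⟩ := hx (s + 2) (arrivals m' (s + 2))
  have hcum : cumBefore σ s = leaderTotal x m s :=
    hSI.cumBefore_eq hxσ s hs.le fun k hk => hm k hk.le
  have hcum1 : step σ s (leaderTotal x m s) = leaderTotal x m (s + 1) := by
    rw [← hcum, ← hSI.cumBefore_eq hxσ (s + 1) hs1.le fun k hk => hm k (by omega), cumBefore]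
  have hreach := hσ.reachable_cumBefore s hs
  rw [hcum] at hreach
  have hcast : ∀ i : Fin (m s),
      σ ⟨s, hs⟩ (Fin.cast (hm s le_rfl).symm i) (leaderTotal x m s) =
        x (s + 1) (arrivals m (s + 1)) (Fin.last s) i := fun i => by
    rw [← hSI.eq_last hs hm (Fin.cast (hm s le_rfl).symm i) i rfl, hxσ, outcome, hcum]
  -- Since `m s > 0`, somebody has arrived and every `W ≥ 0` is a history at which optimality holds.
  have hreach1 : ∀ W, 0 ≤ W → Reachable (arrivals m' (s + 2)) ⟨s + 1, hs1⟩ W := fun W hW =>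
    ⟨hW, fun h => by
      have h1 : m' s = 0 := h ⟨s, hs⟩ (by simp [Fin.lt_def])
      have := hm s le_rfl
      omega⟩
  refine ⟨hreach.1, fun i => hcast i ▸ hσ.nonneg _ _ _ hreach.1, finalTotal σ (s + 1),
    fun W hW => hσ.le_finalTotal _ hW, ?_, ?_, ?_⟩
  · rw [← hcum1, ← finalTotal_step hs]
    exact hσ.interior ⟨s, hs⟩ _ hreach hlt
  · intro W hW hWc
    have hstep : finalTotal σ (s + 1) W = step σ (s + 1) W := by
      rw [finalTotal_step hs1]
      exact finalTotal_end _
    have hint := hσ.interior ⟨s + 1, hs1⟩ W (hreach1 W hW) (hWc.trans_le hXc.2)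
    have key := cournot_total hP hXc hPXc hP' (fun i => σ ⟨s + 1, hs1⟩ i W)
      (hmN.symm ▸ hN : 0 < m' (s + 1)) (fun i => hσ.nonneg _ i W hW) hW hWc (step_of_lt hs1 W)
      (hstep ▸ hint) (fun i y hy => by
        have h1 := hσ.best_total hs1 (hreach1 W hW) i hy
        have he : ∀ V, finalTotal σ (s + 1 + 1) V = V := fun V => finalTotal_end V
        rwa [he, he] at h1)
    rw [hstep]
    refine ⟨key.1, key.2.trans ?_⟩
    rw [← hmN]
  · intro i y hy
    have h1 := hσ.best_total hs hreach (Fin.cast (hm s le_rfl).symm i) hy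
    rwa [hcum1, hcast] at h1

theorem leaderTotal_succ (m : ℕ → ℕ) (s : ℕ) :
    leaderTotal x m (s + 1) =
      leaderTotal x m s + ∑ i, x (s + 1) (arrivals m (s + 1)) (Fin.last s) i :=
  Finset.sum_range_succ _ _

/-- Each firm takes the equal share of the remaining competitive quantity which linear demand would
give it. -/
theorem quantity_eq_share (hP : IsDemand P Xbar) (hXc : Xc ∈ Icc 0 Xbar) (hPXc : P Xc = c)
    (hP' : derivWithin P (Icc 0 Xbar) Xc ≠ 0) (hx : AreEquilibriumQuantities P Xbar c x)
    (hSI : StackelbergIndependent x) (m : ℕ → ℕ) (s : ℕ)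
    (hlt : leaderTotal x m s < Xc ∨ Xc = 0 ∧ leaderTotal x m s = 0) (i : Fin (m s)) :
    x (s + 1) (arrivals m (s + 1)) (Fin.last s) i = (Xc - leaderTotal x m s) / (1 + m s) := by
  set q : Fin (m s) → ℝ := fun j => x (s + 1) (arrivals m (s + 1)) (Fin.last s) j with hq
  have hb : leaderTotal x m s < Xbar := by
    rcases hlt with h | ⟨-, h⟩
    · exact h.trans_le hXc.2
    · exact h ▸ hP.pos
  have hms : 0 < m s := i.pos
  have hreact := fun (N : ℕ) (hN : 0 < N) =>
    exists_reaction hP hXc hPXc hP' hx hSI m s hms hb hN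
  obtain ⟨h0, hq0, R, hR, hRb, hRc, hbest⟩ := hreact 1 one_pos
  have hle : ∀ j : Fin (m s), q j ≤ leaderTotal x m (s + 1) := fun j => by
    have := Finset.single_le_sum (f := q) (fun j _ => hq0 j) (Finset.mem_univ j)
    rw [leaderTotal_succ]
    exact this.trans (le_add_of_nonneg_left h0)
  rcases hlt with hlt | ⟨hXc0, hz⟩
  · obtain ⟨hZ, hpos⟩ := leaders_active hP hXc hPXc q hq0 h0 hlt (leaderTotal_succ m s) hR
      (fun W hW hWc => (hRc W hW hWc).1) hRb hbest
    have hgap : ∀ j, q j = Xc - leaderTotal x m (s + 1) := fun j =>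
      leader_quantity hP hXc hPXc hP' (hpos j) (hle j) hZ fun N hN => by
        obtain ⟨-, -, R, hR, -, hRc, hbest⟩ := hreact N hN
        exact ⟨R, hR, hRc, hbest j⟩
    have hsum : leaderTotal x m (s + 1) = leaderTotal x m s + m s * q i := by
      rw [leaderTotal_succ]
      congr 1
      exact (Finset.sum_congr rfl fun j _ => (hgap j).trans (hgap i).symm).trans (by simp)
    change q i = _
    rw [eq_div_iff (by positivity)]
    have := hgap i
    rw [hsum] at this
    linear_combination this
  -- If `Xc = 0`, any positive quantity pushes the price below cost, so the firm produces nothing.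
  · change q i = _
    rw [hXc0, hz, sub_self, zero_div]
    refine le_antisymm ?_ (hq0 i)
    by_contra! hpos
    have h1 := hR _ ((hq0 i).trans (hle i))
    refine absurd (nonpos_of_competitive_lt hP hXc hPXc ?_ hRb.le
      (by simpa using hbest i 0 le_rfl)) (not_le.2 hpos)
    rw [hXc0]
    exact hpos.trans_le ((hle i).trans h1)

/-- The second conjunct follows from the first and is what `quantity_eq_share` needs for the next
period; `Xc = 0` is separate because the gap is then zero. -/
theorem competitive_sub_leaderTotal (hP : IsDemand P Xbar) (hXc : Xc ∈ Icc 0 Xbar)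
    (hPXc : P Xc = c) (hP' : derivWithin P (Icc 0 Xbar) Xc ≠ 0)
    (hx : AreEquilibriumQuantities P Xbar c x) (hSI : StackelbergIndependent x) (m : ℕ → ℕ)
    (s : ℕ) :
    Xc - leaderTotal x m s = Xc / ∏ k ∈ Finset.range s, (1 + (m k : ℝ)) ∧
      (leaderTotal x m s < Xc ∨ Xc = 0 ∧ leaderTotal x m s = 0) := by
  have of_eq : ∀ s, Xc - leaderTotal x m s = Xc / ∏ k ∈ Finset.range s, (1 + (m k : ℝ)) →
      (leaderTotal x m s < Xc ∨ Xc = 0 ∧ leaderTotal x m s = 0) := by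
    intro s h
    have hprod : 0 < ∏ k ∈ Finset.range s, (1 + (m k : ℝ)) :=
      Finset.prod_pos fun k _ => by positivity
    rcases hXc.1.eq_or_lt with h0 | h0
    · rw [← h0, zero_div] at h
      exact Or.inr ⟨h0.symm, by linarith⟩
    · exact Or.inl (by linarith [div_pos h0 hprod])
  suffices h : _ from ⟨h, of_eq s h⟩
  induction s with
  | zero => simp [leaderTotal]
  | succ s ih =>
    have hs : ∑ i, x (s + 1) (arrivals m (s + 1)) (Fin.last s) i =
        m s * ((Xc - leaderTotal x m s) / (1 + m s)) := by
      rw [Finset.sum_congr rfl fun i _ => quantity_eq_share hP hXc hPXc hP' hx hSI m s (of_eq s ih) i]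
      simp
    have hne : (1 + (m s : ℝ)) ≠ 0 := by positivity
    rw [leaderTotal_succ, hs, Finset.prod_range_succ, ← div_div, ← ih]
    field_simp
    ring

end Independence

end Stackelberg

theorem corollary1 (P : ℝ → ℝ) (Xbar c Xc : ℝ) (hP : Stackelberg.IsDemand P Xbar) (hc : 0 ≤ c)
    (hXc : Xc ∈ Set.Icc 0 Xbar) (hPXc : P Xc = c)
    (hP' : derivWithin P (Set.Icc 0 Xbar) Xc ≠ 0)
    (x : Stackelberg.Quantities) (hx : Stackelberg.AreEquilibriumQuantities P Xbar c x)
    (hSI : Stackelberg.StackelbergIndependent x) :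
    ∀ (T : ℕ) (n : Fin T → ℕ) (s : Fin T), s.val + 1 < T → ∀ i : Fin (n s),
      x T n s i = Xc / ∏ k ∈ Finset.Iic s, (1 + (n k : ℝ)) := by
  intro T n s hs i
  -- Extending by zeros puts games of all lengths on one sequence; terms from `T` on are never
  -- played.
  let m : ℕ → ℕ := fun k => if h : k < T then n ⟨k, h⟩ else 0
  have hm : n = Stackelberg.arrivals m T := by
    funext k
    simp [Stackelberg.arrivals, m]
  clear_value m
  subst hm
  obtain ⟨h1, h2⟩ :=
    Stackelberg.competitive_sub_leaderTotal hP hXc hPXc hP' hx hSI m s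
  have h3 := hSI.eq_last (m := m) s.isLt (fun _ _ => rfl) i i rfl
  have h4 : ∏ k ∈ Finset.Iic s, (1 + (Stackelberg.arrivals m T k : ℝ)) =
      ∏ k ∈ Finset.range (s.val + 1), (1 + (m k : ℝ)) := by
    rw [Nat.range_succ_eq_Iic, ← Fin.map_valEmbedding_Iic, Finset.prod_map]
    rfl
  rw [h4, Finset.prod_range_succ, ← div_div, ← h1]
  exact h3.trans (Stackelberg.quantity_eq_share hP hXc hPXc hP' hx hSI m s h2 i)
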